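/- Let $k$ be a positive integer such that $k(k+1)$ is square-free and $k+1$ is not a prime. Then $k(k+1)$ is a non-Cayley number, that is, there is a vertex-transitive graph with $k(k+1)$ vertices that is not a Cayley graph. More precisely, let $S^{++}(2,k)$ be the graph obtained from the disjoint union of $k+1$ complete graphs $K_k$ by adding exactly one edge between any two distinct copies of $K_k$, in such a way that every vertex is an end of exactly one of the added edges. Then $S^{++}(2,k)$ has $k(k+1)$ vertices, is vertex-transitive, and is not a Cayley graph. Here a graph is vertex-transitive if its automorphism group acts transitively on its vertices, and it is a Cayley graph if it is isomorphic to $\mathrm{Cay}(G,C)$ for some group $G$ and some $C\subset G$ with $1\notin C$ and $C=C^{-1}$, where $\mathrm{Cay}(G,C)$ has vertex set $G$ and $u$ is adjacent to $v$ if and only if $vu^{-1}\in C$. -/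

import Mathlib

/-- A graph is vertex-transitive if its automorphism group acts transitively on the vertices. -/
def IsVertexTransitive {V : Type*} (Γ : SimpleGraph V) : Prop :=
  ∀ u v : V, ∃ σ : Γ ≃g Γ, σ u = v

/-- `C` is a connection set in the group `G`: it avoids `1` and is closed under inversion. -/
def IsConnectionSet {G : Type*} [Group G] (C : Set G) : Prop :=
  1 ∉ C ∧ ∀ c ∈ C, c⁻¹ ∈ C

/-- For a connection set `C`, Mathlib's Cayley graph joins `u` and `v` iff `u⁻¹ * v ∈ C`. Up to the
isomorphism `g ↦ g⁻¹` this is the graph in which `u` and `v` are joined iff `v * u⁻¹ ∈ C`. -/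
theorem IsConnectionSet.mulCayley_adj_inv {G : Type*} [Group G] {C : Set G}
    (hC : IsConnectionSet C) (u v : G) :
    (SimpleGraph.mulCayley C).Adj u⁻¹ v⁻¹ ↔ v * u⁻¹ ∈ C := by
  rw [SimpleGraph.mulCayley_adj]
  simp only [inv_inv]
  constructor
  · rintro ⟨-, h | h⟩
    · simpa using hC.2 _ h
    · exact h
  · intro h
    refine ⟨fun e => hC.1 ?_, Or.inr h⟩
    have e' : u = v := inv_injective e
    subst e'
    simpa using h

universe u

/-- A graph is a Cayley graph if it is isomorphic to `Cay(G, C)` for some group `G` and some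
connection set `C ⊆ G`. -/
def IsCayleyGraph {V : Type u} (Γ : SimpleGraph V) : Prop :=
  ∃ (G : Type u) (_ : Group G) (C : Set G),
    IsConnectionSet C ∧ Nonempty (Γ ≃g SimpleGraph.mulCayley C)

/-- A positive integer `n` is a Cayley number if every vertex-transitive graph of order `n` is a
Cayley graph. -/
def IsCayleyNumber (n : ℕ) : Prop :=
  0 < n ∧ ∀ (V : Type) (Γ : SimpleGraph V), Nat.card V = n →
    IsVertexTransitive Γ → IsCayleyGraph Γ

/-- The set of all non-Cayley numbers, i.e. the positive integers that are not Cayley numbers. -/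
def nonCayleyNumbers : Set ℕ :=
  {n | 0 < n ∧ ¬ IsCayleyNumber n}

/-- The Sierpiński graph `S(n, k)` on the `n`-tuples over a `k`-element alphabet. -/
def sierpinskiGraph (n k : ℕ) : SimpleGraph (Fin n → Fin k) where
  Adj u v := ∃ t : Fin n, (∀ i, i < t → u i = v i) ∧ u t ≠ v t ∧
    ∀ j, t < j → u j = v t ∧ v j = u t
  symm := ⟨by
    rintro u v ⟨t, h1, h2, h3⟩
    exact ⟨t, fun i hi => (h1 i hi).symm, h2.symm, fun j hj => (h3 j hj).symm⟩⟩
  loopless := ⟨by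
    rintro u ⟨t, -, h, -⟩
    exact h rfl⟩

/-- The graph `S⁺⁺(n, k)`, for `n ≥ 1`: the disjoint union of `k + 1` copies of `S(n - 1, k)`,
together with exactly one edge between any two distinct copies, these edges joining extreme
vertices (the constant tuples), each extreme vertex being used once. The extreme vertex
`(a, …, a)` of the copy `i` is reserved for the edge to the copy `i.succAbove a`, where
`i.succAbove` is the increasing bijection from `Fin k` onto the copies other than `i`. -/
def sierpinskiPlusPlus (n k : ℕ) : SimpleGraph (Fin (k + 1) × (Fin (n - 1) → Fin k)) where
  Adj x y := (x.1 = y.1 ∧ (sierpinskiGraph (n - 1) k).Adj x.2 y.2) ∨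
    ∃ a b : Fin k, x.2 = (fun _ => a) ∧ y.2 = (fun _ => b) ∧
      x.1.succAbove a = y.1 ∧ y.1.succAbove b = x.1
  symm := ⟨by
    rintro x y (⟨h1, h2⟩ | ⟨a, b, h1, h2, h3, h4⟩)
    · exact Or.inl ⟨h1.symm, h2.symm⟩
    · exact Or.inr ⟨b, a, h2, h1, h4, h3⟩⟩
  loopless := ⟨by
    rintro x (⟨-, h⟩ | ⟨a, b, -, -, h, -⟩)
    · exact (sierpinskiGraph (n - 1) k).loopless.irrefl _ h
    · exact Fin.succAbove_ne _ _ h⟩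

/-- For `n = 1` the construction gives the complete graph on `k + 1` vertices. -/
theorem sierpinskiPlusPlus_one (k : ℕ) : sierpinskiPlusPlus 1 k = ⊤ := by
  ext x y
  rw [SimpleGraph.top_adj]
  refine ⟨fun h => h.ne, fun h => Or.inr ?_⟩
  have hne : x.1 ≠ y.1 := fun e => h (Prod.ext e (funext fun i => i.elim0))
  obtain ⟨a, ha⟩ := Fin.exists_succAbove_eq hne.symm
  obtain ⟨b, hb⟩ := Fin.exists_succAbove_eq hne
  exact ⟨a, b, funext fun i => i.elim0, funext fun i => i.elim0, ha, hb⟩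

/-! A vertex of $S^{++}(2,k)$ is an ordered pair of distinct copies: its own and the one its added
edge reaches. Permutations of the $k+1$ copies give vertex-transitivity. When $k+1 \ge 4$, adjacency
determines the cliques and the swap, so automorphisms act on the copies, and a regular group of
automorphisms would be sharply 2-transitive of degree $n = k+1$. In such a group every
fixed-point-free element has at least $n-1$ conjugates, yet by Burnside's count at most $n-1$
elements are fixed-point-free. Elements of prime order dividing $n$ are fixed-point-free, so two
such primes would give two disjoint classes, too many elements. But $k+1$, square-free and not
prime, has two prime divisors. -/

section SharplyTwoTransitive

/-- The action of `G` on `X` is sharply transitive on ordered pairs of distinct points. -/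
def IsSharplyTwoTransitive (G X : Type*) [Group G] [MulAction G X] : Prop :=
  ∀ a b c d : X, a ≠ b → c ≠ d → ∃! g : G, g • a = c ∧ g • b = d

variable {G X : Type*} [Group G] [MulAction G X]

theorem IsSharplyTwoTransitive.eq_one (h : IsSharplyTwoTransitive G X) {g : G} {a b : X}
    (hab : a ≠ b) (ha : g • a = a) (hb : g • b = b) : g = 1 :=
  (h a b a b hab hab).unique ⟨ha, hb⟩ ⟨one_smul _ _, one_smul _ _⟩

theorem IsSharplyTwoTransitive.isPretransitive [Nontrivial X]
    (h : IsSharplyTwoTransitive G X) : MulAction.IsPretransitive G X := by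
  refine ⟨fun a c => ?_⟩
  obtain ⟨b, hb⟩ := exists_ne a
  obtain ⟨d, hd⟩ := exists_ne c
  obtain ⟨g, hg, -⟩ := h a b c d hb.symm hd.symm
  exact ⟨g, hg.1⟩

/-- The stabilizer of `x` is regular on the other points, so `g ↦ g • y` is a bijection for any
fixed `y ≠ x`. -/
theorem IsSharplyTwoTransitive.card_stabilizer [Nontrivial X]
    (h : IsSharplyTwoTransitive G X) (x : X) :
    Nat.card (MulAction.stabilizer G x) = Nat.card {y : X // y ≠ x} := by
  obtain ⟨y, hy⟩ := exists_ne x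
  refine Nat.card_congr (Equiv.ofBijective
    (fun g => ⟨(g : G) • y, fun e => hy ?_⟩) ⟨?_, ?_⟩)
  · have hg : (g : G) • x = x := g.2
    exact MulAction.injective (g : G) (e.trans hg.symm)
  · intro g g' e
    have e' : (g : G) • y = (g' : G) • y := congrArg Subtype.val e
    exact Subtype.ext ((h x y x ((g' : G) • y) hy.symm
      (fun e => hy (MulAction.injective (g' : G) (e.symm.trans
        (show (g' : G) • x = x from g'.2).symm)))).unique ⟨g.2, e'⟩ ⟨g'.2, rfl⟩)
  · rintro ⟨z, hz⟩
    obtain ⟨g, hg, -⟩ := h x y x z hy.symm hz.symm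
    exact ⟨⟨g, hg.1⟩, Subtype.ext hg.2⟩

/-- An element without fixed points has at least `|X| - 1` conjugates. -/
theorem IsSharplyTwoTransitive.card_stabilizer_le_conj [Nontrivial X] [Finite G]
    (h : IsSharplyTwoTransitive G X) (x : X) {g : G} (hg : g • x ≠ x) :
    Nat.card (MulAction.stabilizer G x) ≤ Nat.card {g' : G // IsConj g g'} := by
  refine Nat.card_le_card_of_injective
    (fun s => ⟨(s : G) * g * (s : G)⁻¹, isConj_iff.2 ⟨s, rfl⟩⟩) fun s t e => ?_
  have e' : (s : G) * g * (s : G)⁻¹ = t * g * (t : G)⁻¹ := congrArg Subtype.val e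
  have hs : (s : G) • x = x := s.2
  have ht : (t : G) • x = x := t.2
  have hs' : (s : G)⁻¹ • x = x := inv_smul_eq_iff.2 hs.symm
  have ht' : (t : G)⁻¹ • x = x := inv_smul_eq_iff.2 ht.symm
  -- Equal conjugates are evaluated at `x`, so `s` and `t` agree at both `x` and `g • x`.
  have key : (s : G) • g • x = (t : G) • g • x := by
    have := congrArg (· • x) e'
    simpa only [mul_smul, hs', ht'] using this
  refine Subtype.ext ((h x (g • x) x ((t : G) • g • x) hg.symm fun e => hg ?_).unique
    ⟨hs, key⟩ ⟨ht, rfl⟩)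
  exact MulAction.injective (t : G) (e.symm.trans ht.symm)

theorem IsSharplyTwoTransitive.card_eq [Nontrivial X] [Fintype X]
    (h : IsSharplyTwoTransitive G X) :
    Nat.card G = Fintype.card X * (Fintype.card X - 1) := by
  classical
  have := h.isPretransitive
  obtain ⟨x⟩ : Nonempty X := inferInstance
  rw [← (MulAction.stabilizer G x).card_mul_index, MulAction.index_stabilizer_of_transitive,
    h.card_stabilizer x, Nat.card_eq_fintype_card, Nat.card_eq_fintype_card, mul_comm,
    Fintype.card_subtype_compl, Fintype.card_subtype_eq]

/-- There are at most `|X| - 1` elements without fixed points. -/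
theorem IsSharplyTwoTransitive.card_fixedPointFree [Nontrivial X] [Fintype X] [Finite G]
    (h : IsSharplyTwoTransitive G X) :
    Nat.card {g : G // ∀ x : X, g • x ≠ x} ≤ Fintype.card X - 1 := by
  classical
  have := Fintype.ofFinite G
  have := h.isPretransitive
  have hb := MulAction.sum_card_fixedBy_eq_card_orbits_mul_card_group G X
  have horb : Fintype.card (Quotient (MulAction.orbitRel G X)) = 1 :=
    Fintype.card_eq_one_iff_nonempty_unique.2
      ((MulAction.pretransitive_iff_unique_quotient_of_nonempty G X).1 this)
  rw [horb, one_mul, ← Nat.card_eq_fintype_card (α := G), h.card_eq] at hb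
  -- A nonidentity element fixes at most one point. Summed over `G` and compared with Burnside's
  -- count, this leaves `|X| - 1` for the fixed-point-free elements.
  have hle : ∀ g : G, Fintype.card (MulAction.fixedBy X g) +
      (if ∀ x : X, g • x ≠ x then 1 else 0) ≤
        1 + if g = 1 then Fintype.card X - 1 else 0 := by
    intro g
    by_cases hg : g = 1
    · subst hg
      have h1 : Fintype.card (MulAction.fixedBy X (1 : G)) = Fintype.card X := by
        simp [MulAction.fixedBy]
      have := Fintype.one_lt_card (α := X)
      rw [h1, if_neg (by simp), if_pos rfl]
      omega
    · rw [if_neg hg]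
      split_ifs with hf
      · have : IsEmpty (MulAction.fixedBy X g) := ⟨fun x => hf x.1 x.2⟩
        simp
      · have : Subsingleton (MulAction.fixedBy X g) :=
          ⟨fun a b => by_contra fun hab =>
            hg (h.eq_one (fun e => hab (Subtype.ext e)) a.2 b.2)⟩
        simpa using Fintype.card_le_one_iff_subsingleton.2 this
  have hsum := Finset.sum_le_sum fun g (_ : g ∈ (Finset.univ : Finset G)) => hle g
  rw [Finset.sum_add_distrib, Finset.sum_add_distrib, hb, Finset.sum_ite_eq' Finset.univ,
    if_pos (Finset.mem_univ _), Finset.sum_const, Finset.card_univ,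
    ← Nat.card_eq_fintype_card (α := G), h.card_eq, Finset.sum_boole] at hsum
  rw [Nat.card_eq_fintype_card, Fintype.card_subtype]
  simpa using hsum

/-- The number of fixed points is congruent to `|X|`, hence to 0, modulo `p`; but a fixed point of
`g ≠ 1` would be the only one. -/
theorem IsSharplyTwoTransitive.smul_ne_of_orderOf_eq_prime [Nontrivial X] [Fintype X]
    (h : IsSharplyTwoTransitive G X) {p : ℕ} (hp : p.Prime) (hpX : p ∣ Fintype.card X)
    {g : G} (hg : orderOf g = p) (x : X) : g • x ≠ x := by
  classical
  intro hx
  have := Fact.mk hp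
  have hmod := Equiv.Perm.card_fixedPoints_modEq (f := MulAction.toEndHom (α := X) g) (p := p)
    (n := 1) (by rw [pow_one, ← map_pow, ← hg, pow_orderOf_eq_one, map_one])
  have hd : p ∣ _ := Nat.modEq_zero_iff_dvd.1 (hmod.symm.trans (Nat.modEq_zero_iff_dvd.2 hpX))
  refine hp.one_lt.ne' (Nat.dvd_one.1 (hd.trans (dvd_of_eq (Fintype.card_eq_one_iff.2
    ⟨⟨x, hx⟩, fun y => Subtype.ext (by_contra fun hyx => ?_)⟩))))
  exact hp.one_lt.ne' (hg ▸ orderOf_eq_one_iff.2 (h.eq_one hyx y.2 hx))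

/-- The degree of a finite sharply two-transitive group has only one prime divisor. -/
theorem IsSharplyTwoTransitive.prime_unique [Nontrivial X] [Fintype X] [Finite G]
    (h : IsSharplyTwoTransitive G X) {p q : ℕ} (hp : p.Prime) (hq : q.Prime)
    (hpX : p ∣ Fintype.card X) (hqX : q ∣ Fintype.card X) : p = q := by
  classical
  by_contra hpq
  obtain ⟨x⟩ : Nonempty X := inferInstance
  have hpf := Fact.mk hp
  have hqf := Fact.mk hq
  obtain ⟨a, ha⟩ := exists_prime_orderOf_dvd_card' (G := G) p
    (h.card_eq ▸ Dvd.dvd.mul_right hpX _)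
  obtain ⟨b, hb⟩ := exists_prime_orderOf_dvd_card' (G := G) q
    (h.card_eq ▸ Dvd.dvd.mul_right hqX _)
  have order_conj : ∀ {c c' : G}, IsConj c c' → orderOf c' = orderOf c := by
    intro c c' hc
    obtain ⟨s, rfl⟩ := isConj_iff.1 hc
    exact orderOf_injective (MulAut.conj s).toMonoidHom (MulAut.conj s).injective c
  have hA := h.card_stabilizer_le_conj x (h.smul_ne_of_orderOf_eq_prime hp hpX ha x)
  have hB := h.card_stabilizer_le_conj x (h.smul_ne_of_orderOf_eq_prime hq hqX hb x)
  have hsum : Nat.card ({g // IsConj a g} ⊕ {g // IsConj b g}) ≤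
      Nat.card {g : G // ∀ x : X, g • x ≠ x} := by
    refine Nat.card_le_card_of_injective (Sum.elim
      (fun g => ⟨g.1, h.smul_ne_of_orderOf_eq_prime hp hpX ((order_conj g.2).trans ha)⟩)
      (fun g => ⟨g.1, h.smul_ne_of_orderOf_eq_prime hq hqX ((order_conj g.2).trans hb)⟩)) ?_
    refine Function.Injective.sumElim ?_ ?_ ?_
    · exact fun g g' e => Subtype.ext (Subtype.mk.inj e)
    · exact fun g g' e => Subtype.ext (Subtype.mk.inj e)
    · intro g g' e
      have e' : g.1 = g'.1 := congrArg Subtype.val e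
      exact hpq (by rw [← ha, ← hb, ← order_conj g.2, ← order_conj g'.2, e'])
  have hF := h.card_fixedPointFree
  have h1 := Fintype.one_lt_card (α := X)
  have hs := h.card_stabilizer x
  rw [Nat.card_eq_fintype_card (α := {y : X // y ≠ x}), Fintype.card_subtype_compl,
    Fintype.card_subtype_eq] at hs
  rw [Nat.card_sum] at hsum
  omega

end SharplyTwoTransitive

/-! ### The pair graph and its automorphisms -/

section PairGraph

/-- The graph on the ordered pairs of distinct elements of `α` in which two pairs are joined if
they have the same first entry or are swapped versions of each other. -/
def pairGraph (α : Type*) : SimpleGraph {p : α × α // p.1 ≠ p.2} where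
  Adj p q := p ≠ q ∧ (p.1.1 = q.1.1 ∨ p.1.1 = q.1.2 ∧ p.1.2 = q.1.1)
  symm := ⟨by
    rintro p q ⟨h, h' | h'⟩
    · exact ⟨h.symm, Or.inl h'.symm⟩
    · exact ⟨h.symm, Or.inr ⟨h'.2.symm, h'.1.symm⟩⟩⟩
  loopless := ⟨fun _ h => h.1 rfl⟩

variable {α : Type*}

theorem pairGraph_adj {p q : {p : α × α // p.1 ≠ p.2}} :
    (pairGraph α).Adj p q ↔ p ≠ q ∧ (p.1.1 = q.1.1 ∨ p.1.1 = q.1.2 ∧ p.1.2 = q.1.1) :=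
  Iff.rfl

theorem pairGraph_isVertexTransitive : IsVertexTransitive (pairGraph α) := by
  rintro ⟨⟨a, b⟩, hab⟩ ⟨⟨c, d⟩, hcd⟩
  obtain ⟨σ, hσ⟩ := (MulAction.is_two_pretransitive_iff (G := Equiv.Perm α) (α := α)).1
    (Equiv.Perm.isMultiplyPretransitive α 2) hab hcd
  let e : {p : α × α // p.1 ≠ p.2} ≃ {p : α × α // p.1 ≠ p.2} :=
    (Equiv.prodCongr σ σ).subtypeEquiv fun p => by simp
  refine ⟨⟨e, ?_⟩, ?_⟩
  · intro p q
    rw [pairGraph_adj, pairGraph_adj, e.injective.ne_iff]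
    simp [e]
  · exact Subtype.ext (Prod.ext hσ.1 hσ.2)

/-- Two distinct vertices have the same first entry iff they are joined and lie in a triangle. -/
theorem pairGraph_fst_eq_iff [Fintype α] (hα : 4 ≤ Fintype.card α)
    {p q : {p : α × α // p.1 ≠ p.2}} (hpq : p ≠ q) :
    p.1.1 = q.1.1 ↔ (pairGraph α).Adj p q ∧
      ∃ r, (pairGraph α).Adj p r ∧ (pairGraph α).Adj q r := by
  classical
  obtain ⟨⟨i, j⟩, hij⟩ := p
  obtain ⟨⟨i', l⟩, hil⟩ := q
  simp only [pairGraph_adj, ne_eq, Subtype.mk.injEq, Prod.mk.injEq, Subtype.exists, Prod.exists]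
    at *
  constructor
  · rintro rfl
    refine ⟨⟨hpq, Or.inl rfl⟩, ?_⟩
    -- A fourth letter makes `(i, m)` the apex of the triangle.
    obtain ⟨m, hm⟩ : ∃ m, m ∉ ({i, j, l} : Finset α) := by
      by_contra! hall
      have h1 := Finset.card_le_card (show Finset.univ ⊆ ({i, j, l} : Finset α) from
        fun m _ => hall m)
      have h2 := Finset.card_le_three (a := i) (b := j) (c := l)
      rw [Finset.card_univ] at h1
      omega
    simp only [Finset.mem_insert, Finset.mem_singleton, not_or] at hm
    exact ⟨i, m, fun e => hm.1 e.symm, ⟨fun e => hm.2.1 e.2.symm, Or.inl rfl⟩,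
      fun e => hm.2.2 e.2.symm, Or.inl rfl⟩
  -- A swap edge lies in no triangle: the other neighbours of its two ends have different first
  -- entries.
  · grind

theorem pairGraph_iso_fst_eq [Fintype α] (hα : 4 ≤ Fintype.card α)
    (σ : pairGraph α ≃g pairGraph α) (p q : {p : α × α // p.1 ≠ p.2}) :
    (σ p).1.1 = (σ q).1.1 ↔ p.1.1 = q.1.1 := by
  by_cases hpq : p = q
  · simp [hpq]
  · rw [pairGraph_fst_eq_iff hα hpq, pairGraph_fst_eq_iff hα (σ.injective.ne hpq),
      σ.map_adj_iff, σ.surjective.exists]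
    simp only [σ.map_adj_iff]

/-- The pair with its entries swapped. -/
def swapPair (p : {p : α × α // p.1 ≠ p.2}) : {p : α × α // p.1 ≠ p.2} :=
  ⟨p.1.swap, p.2.symm⟩

/-- The swapped pair is the only neighbour with a different first entry. -/
theorem pairGraph_iso_swapPair [Fintype α] (hα : 4 ≤ Fintype.card α)
    (σ : pairGraph α ≃g pairGraph α) (p : {p : α × α // p.1 ≠ p.2}) :
    σ (swapPair p) = swapPair (σ p) := by
  have hne : (swapPair p).1.1 ≠ p.1.1 := p.2.symm
  have hadj : (pairGraph α).Adj (σ (swapPair p)) (σ p) :=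
    σ.map_adj_iff.2 ⟨fun e => hne (by rw [e]), Or.inr ⟨rfl, rfl⟩⟩
  rcases hadj.2 with h | h
  · exact absurd ((pairGraph_iso_fst_eq hα σ _ _).1 h) hne
  · exact Subtype.ext (Prod.ext h.1 h.2)

/-- If `pairGraph α` is a Cayley graph, then some group acts sharply two-transitively on `α`. -/
theorem exists_isSharplyTwoTransitive_of_isCayleyGraph {α : Type u} [Fintype α]
    (hα : 4 ≤ Fintype.card α) (h : IsCayleyGraph (pairGraph α)) :
    ∃ (G : Type u) (_ : Group G) (_ : Finite G) (_ : MulAction G α),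
      IsSharplyTwoTransitive G α := by
  classical
  obtain ⟨G, _, C, -, ⟨φ⟩⟩ := h
  have : Nontrivial α := Fintype.one_lt_card_iff_nontrivial.1 (by omega)
  -- Left translation by `g`, carried to the pairs along `φ`.
  let τ (g : G) : pairGraph α ≃g pairGraph α :=
    { toEquiv := (φ.toEquiv.trans (Equiv.mulLeft g)).trans φ.toEquiv.symm
      map_rel_iff' := by
        intro p q
        change (pairGraph α).Adj (φ.symm (g * φ p)) (φ.symm (g * φ q)) ↔ _
        rw [φ.symm.map_adj_iff, ← φ.map_adj_iff, SimpleGraph.mulCayley_adj,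
          SimpleGraph.mulCayley_adj]
        simp [mul_assoc] }
  have hτ : ∀ g p, τ g p = φ.symm (g * φ p) := fun _ _ => rfl
  have hφτ : ∀ g p, φ (τ g p) = g * φ p := fun g p => by rw [hτ, φ.apply_symm_apply]
  choose o ho using fun i : α => exists_ne i
  -- The choice of second entry `o i` is immaterial, by `pairGraph_iso_fst_eq`.
  let act (g : G) (i : α) : α := (τ g ⟨(i, o i), (ho i).symm⟩).1.1
  have hfst : ∀ g p, (τ g p).1.1 = act g p.1.1 := fun g p =>
    (pairGraph_iso_fst_eq hα (τ g) _ _).2 rfl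
  have hsnd : ∀ g p, (τ g p).1.2 = act g p.1.2 := fun g p => by
    have := hfst g (swapPair p)
    rwa [pairGraph_iso_swapPair hα] at this
  let _ : MulAction G α :=
    { smul := act
      one_smul := fun i => by
        change (τ 1 _).1.1 = i
        rw [hτ, one_mul, φ.symm_apply_apply]
      mul_smul := fun g g' i => by
        change (τ (g * g') ⟨(i, o i), (ho i).symm⟩).1.1 =
          act g ((τ g' ⟨(i, o i), (ho i).symm⟩).1.1)
        rw [← hfst, hτ, hτ g, hφτ, mul_assoc] }
  refine ⟨G, inferInstance, Finite.of_equiv _ φ.toEquiv, inferInstance, ?_⟩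
  intro a b c d hab hcd
  -- Left translation is regular on vertices, and vertices are ordered pairs.
  have key : ∀ g : G, (g • a = c ∧ g • b = d) ↔
      g = φ ⟨(c, d), hcd⟩ * (φ ⟨(a, b), hab⟩)⁻¹ := by
    intro g
    rw [eq_mul_inv_iff_mul_eq, ← hφτ, φ.injective.eq_iff, Subtype.ext_iff, Prod.ext_iff, hfst,
      hsnd]
    rfl
  exact ⟨_, (key _).2 rfl, fun g hg => (key g).1 hg⟩

end PairGraph

/-! ### Transfer to $S^{++}(2,k)$ and conclusion -/

theorem IsVertexTransitive.of_iso {V W : Type*} {Γ : SimpleGraph V} {Δ : SimpleGraph W}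
    (e : Γ ≃g Δ) (h : IsVertexTransitive Δ) : IsVertexTransitive Γ := by
  intro u v
  obtain ⟨σ, hσ⟩ := h (e u) (e v)
  exact ⟨(e.trans σ).trans e.symm, by simp [hσ]⟩

theorem IsCayleyGraph.of_iso {V W : Type u} {Γ : SimpleGraph V} {Δ : SimpleGraph W}
    (e : Γ ≃g Δ) (h : IsCayleyGraph Γ) : IsCayleyGraph Δ := by
  obtain ⟨G, _, C, hC, ⟨φ⟩⟩ := h
  exact ⟨G, inferInstance, C, hC, ⟨e.symm.trans φ⟩⟩

theorem sierpinskiGraph_one_adj {k : ℕ} {u v : Fin 1 → Fin k} :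
    (sierpinskiGraph 1 k).Adj u v ↔ u ≠ v := by
  constructor
  · exact fun h => h.ne
  · intro h
    refine ⟨0, fun i hi => absurd hi (by omega), fun e => h (funext fun i => ?_),
      fun j hj => absurd hj (by omega)⟩
    rwa [Subsingleton.elim i 0]

/-- The vertex `u` of the copy `i` of `S⁺⁺(2, k)` corresponds to the pair `(i, j)`, where `j` is
the copy reached by the added edge at that vertex. -/
theorem nonempty_sierpinskiPlusPlus_two_iso (k : ℕ) :
    Nonempty (sierpinskiPlusPlus 2 k ≃g pairGraph (Fin (k + 1))) := by
  let f (x : Fin (k + 1) × (Fin (2 - 1) → Fin k)) :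
      {p : Fin (k + 1) × Fin (k + 1) // p.1 ≠ p.2} :=
    ⟨(x.1, x.1.succAbove (x.2 0)), (Fin.succAbove_ne _ _).symm⟩
  have hext : ∀ u v : Fin 1 → Fin k, u 0 = v 0 → u = v := fun u v h =>
    funext fun i => by rwa [Subsingleton.elim i 0]
  have hf : Function.Bijective f := by
    constructor
    · rintro ⟨i, u⟩ ⟨i', v⟩ e
      simp only [f, Subtype.mk.injEq, Prod.mk.injEq] at e
      obtain ⟨rfl, e⟩ := e
      exact Prod.ext rfl (hext u v (Fin.succAbove_right_injective e))
    · rintro ⟨⟨i, j⟩, hij⟩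
      obtain ⟨a, ha⟩ := Fin.exists_succAbove_eq (Ne.symm hij)
      exact ⟨(i, fun _ => a), Subtype.ext (Prod.ext rfl ha)⟩
  refine ⟨⟨Equiv.ofBijective f hf, ?_⟩⟩
  rintro ⟨i, u⟩ ⟨i', v⟩
  rw [Equiv.ofBijective_apply, Equiv.ofBijective_apply, pairGraph_adj, hf.injective.ne_iff]
  change _ ↔ (i = i' ∧ (sierpinskiGraph 1 k).Adj u v) ∨
    ∃ a b : Fin k, u = (fun _ => a) ∧ v = (fun _ => b) ∧ i.succAbove a = i' ∧ i'.succAbove b = i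
  rw [sierpinskiGraph_one_adj]
  change (_ ∧ (i = i' ∨ i = i'.succAbove (v 0) ∧ i.succAbove (u 0) = i')) ↔ _
  constructor
  · rintro ⟨h, rfl | ⟨h1, h2⟩⟩
    · exact Or.inl ⟨rfl, fun e => h (Prod.ext rfl e)⟩
    · exact Or.inr ⟨u 0, v 0, hext _ _ rfl, hext _ _ rfl, h2, h1.symm⟩
  · rintro (⟨rfl, h⟩ | ⟨a, b, rfl, rfl, h1, h2⟩)
    · exact ⟨fun e => h (congrArg Prod.snd e), Or.inl rfl⟩
    · refine ⟨fun e => ?_, Or.inr ⟨h2.symm, h1⟩⟩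
      have e1 : i = i' := congrArg Prod.fst e
      exact Fin.succAbove_ne i a (h1.trans e1.symm)

theorem Squarefree.exists_prime_ne_dvd {n : ℕ} (h : Squarefree n) (h1 : n ≠ 1)
    (hn : ¬ n.Prime) : ∃ p q : ℕ, p.Prime ∧ q.Prime ∧ p ≠ q ∧ p ∣ n ∧ q ∣ n := by
  have hp := Nat.minFac_prime h1
  obtain ⟨m, hm⟩ := Nat.minFac_dvd n
  have hm1 : m ≠ 1 := by
    rintro rfl
    rw [mul_one] at hm
    exact hn (hm ▸ hp)
  refine ⟨n.minFac, m.minFac, hp, Nat.minFac_prime hm1, fun e => ?_, Nat.minFac_dvd n,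
    (Nat.minFac_dvd m).trans ⟨n.minFac, by rw [mul_comm]; exact hm⟩⟩
  have hd : n.minFac * n.minFac ∣ n := by
    conv_rhs => rw [hm]
    exact mul_dvd_mul_left _ (e ▸ Nat.minFac_dvd m)
  exact hp.not_isUnit (h _ hd)

theorem mainTheorem9 (k : ℕ) (hk : 0 < k) (hsq : Squarefree (k * (k + 1)))
    (hp : ¬ (k + 1).Prime) :
    k * (k + 1) ∈ nonCayleyNumbers ∧
      Nat.card (Fin (k + 1) × (Fin (2 - 1) → Fin k)) = k * (k + 1) ∧
      IsVertexTransitive (sierpinskiPlusPlus 2 k) ∧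
      ¬ IsCayleyGraph (sierpinskiPlusPlus 2 k) := by
  obtain ⟨e⟩ := nonempty_sierpinskiPlusPlus_two_iso k
  have hcard : Nat.card (Fin (k + 1) × (Fin (2 - 1) → Fin k)) = k * (k + 1) := by
    simp [mul_comm]
  have hvt : IsVertexTransitive (sierpinskiPlusPlus 2 k) :=
    pairGraph_isVertexTransitive.of_iso e
  -- This supplies the four letters that the pair-graph lemmas need.
  have hk3 : 3 ≤ k := by
    by_contra! hlt
    interval_cases k
    · exact hp Nat.prime_two
    · exact hp Nat.prime_three
  have hnc : ¬ IsCayleyGraph (sierpinskiPlusPlus 2 k) := by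
    intro hc
    have : Nontrivial (Fin (k + 1)) := Fin.nontrivial_iff_two_le.2 (by omega)
    obtain ⟨G, _, _, _, hG⟩ := exists_isSharplyTwoTransitive_of_isCayleyGraph
      (by rw [Fintype.card_fin]; omega) (hc.of_iso e)
    obtain ⟨p, q, hpp, hqp, hpq, hpd, hqd⟩ :=
      (hsq.squarefree_of_dvd (Dvd.intro_left k rfl)).exists_prime_ne_dvd (by omega) hp
    exact hpq (hG.prime_unique hpp hqp (by rwa [Fintype.card_fin]) (by rwa [Fintype.card_fin]))
  exact ⟨⟨by positivity, fun h => hnc (h.2 _ _ hcard hvt)⟩, hcard, hvt, hnc⟩
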